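/- Let $n\ge 2$ be an integer and $\alpha\in\mathbb C$. Let $\Gamma$ be the star graph formed by $n$ copies of $[0,\pi]$ glued at the endpoint $0$; write $u=(u_1,\dots,u_n)$ for functions on $\Gamma$, let $L^2(\Gamma)=L^2(0,\pi)^n$, $H^2(\Gamma^*)=H^2(0,\pi)^n$, and let $\dot H^1_0(\Gamma)$ be the space of all $u\in H^1(0,\pi)^n$ such that $u_j(\pi)=0$ for all $j$ and $u_1(0)=\dots=u_n(0)=:u(0)$ (values of continuous representatives). On $\mathcal H=\dot H^1_0(\Gamma)\times L^2(\Gamma)$ let $A_n(\alpha)$ be the operator $$A_n(\alpha)\begin{pmatrix}u\\ v\end{pmatrix}=\begin{pmatrix}v\\ u''\end{pmatrix},\qquad \operatorname{dom}A_n(\alpha)=\Big\{(u,v)\in\big(\dot H^1_0(\Gamma)\cap H^2(\Gamma^*)\big)\times\dot H^1_0(\Gamma)\;:\;\sum_{j=1}^n u_j'(0)=\alpha v(0)\Big\},$$ with derivatives taken componentwise. Let $$S_n(\lambda;\alpha)=\frac{\sinh(\lambda\pi)}{\lambda}\big(n\cosh(\lambda\pi)+\alpha\sinh(\lambda\pi)\big)\quad(\lambda\ne0),\qquad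 S_n(0;\alpha)=n\pi .$$ Then $S_n(\cdot;\alpha)$ is an entire function, and $\lambda\in\mathbb C$ is an eigenvalue of $A_n(\alpha)$ if and only if $S_n(\lambda;\alpha)=0$. Moreover, for every eigenvalue $\lambda$ of $A_n(\alpha)$ the index $$\iota(\lambda)=\min\{k\in\mathbb N:\ \ker(A_n(\alpha)-\lambda I)^k=\ker(A_n(\alpha)-\lambda I)^{k+1}\}$$ exists and equals the multiplicity of $\lambda$ as a zero of $S_n(\cdot;\alpha)$. -/

import Mathlib

open MeasureTheory
open scoped ContDiff

noncomputable section

/-! ### Partially defined operators: composition, powers, eigenvalues, index -/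

namespace PartialOp

variable {E : Type*} [AddCommGroup E] [Module ℂ E]

/-- The composition `S ∘ T` of two partially defined operators, with its natural domain
`{x ∈ dom T | T x ∈ dom S}`. -/
def pcomp (S T : E →ₗ.[ℂ] E) : E →ₗ.[ℂ] E where
  domain :=
    { carrier := {x | ∃ h : x ∈ T.domain, T ⟨x, h⟩ ∈ S.domain}
      zero_mem' := ⟨T.domain.zero_mem, by
        have h0 : T ⟨0, T.domain.zero_mem⟩ = 0 := T.map_zero
        rw [h0]; exact S.domain.zero_mem⟩
      add_mem' := by
        rintro x y ⟨hx, hx'⟩ ⟨hy, hy'⟩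
        refine ⟨T.domain.add_mem hx hy, ?_⟩
        have h0 : T ⟨x + y, T.domain.add_mem hx hy⟩ = T ⟨x, hx⟩ + T ⟨y, hy⟩ :=
          T.map_add ⟨x, hx⟩ ⟨y, hy⟩
        rw [h0]; exact S.domain.add_mem hx' hy'
      smul_mem' := by
        rintro c x ⟨hx, hx'⟩
        refine ⟨T.domain.smul_mem c hx, ?_⟩
        have h0 : T ⟨c • x, T.domain.smul_mem c hx⟩ = c • T ⟨x, hx⟩ :=
          T.map_smul c ⟨x, hx⟩
        rw [h0]; exact S.domain.smul_mem c hx' }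
  toFun :=
    { toFun := fun x => S ⟨T ⟨x.1, x.2.1⟩, x.2.2⟩
      map_add' := by
        rintro ⟨x, hx, hx'⟩ ⟨y, hy, hy'⟩
        have h0 : T ⟨x + y, T.domain.add_mem hx hy⟩ = T ⟨x, hx⟩ + T ⟨y, hy⟩ :=
          T.map_add ⟨x, hx⟩ ⟨y, hy⟩
        rw [← S.map_add]
        congr 1
        exact Subtype.ext h0
      map_smul' := by
        rintro c ⟨x, hx, hx'⟩
        have h0 : T ⟨c • x, T.domain.smul_mem c hx⟩ = c • T ⟨x, hx⟩ :=
          T.map_smul c ⟨x, hx⟩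
        rw [RingHom.id_apply, ← S.map_smul]
        congr 1
        exact Subtype.ext h0 }

/-- The identity operator, everywhere defined. -/
def ident : E →ₗ.[ℂ] E := (LinearMap.id : E →ₗ[ℂ] E).toPMap ⊤

/-- The powers `T ^ k` of a partially defined operator, each with its natural domain. -/
def ppow (T : E →ₗ.[ℂ] E) : ℕ → (E →ₗ.[ℂ] E)
  | 0 => ident
  | k + 1 => pcomp (ppow T k) T

/-- The kernel `{x ∈ dom T | T x = 0}`. -/
def ker (T : E →ₗ.[ℂ] E) : Set E := {x | ∃ h : x ∈ T.domain, T ⟨x, h⟩ = 0}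

/-- `l` is an eigenvalue of `T` (a point of the point spectrum). -/
def IsEigenvalue (T : E →ₗ.[ℂ] E) (l : ℂ) : Prop :=
  ∃ x : T.domain, (x : E) ≠ 0 ∧ T x = l • (x : E)

/-- `m` is the index of `l` for `T`: the least `k` with
`ker (T - l) ^ k = ker (T - l) ^ (k + 1)`. -/
def IsIndex (T : E →ₗ.[ℂ] E) (l : ℂ) (m : ℕ) : Prop :=
  IsLeast {k : ℕ | ker (ppow (T - l • ident) k) = ker (ppow (T - l • ident) (k + 1))} m

end PartialOp

/-! ### Sobolev functions on the interval `(0, π)` -/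

namespace StarGraph

/-- The space `L²(0, π)` of complex-valued functions. -/
abbrev L2Edge : Type := Lp ℂ 2 (volume.restrict (Set.Ioo (0 : ℝ) Real.pi))

/-- `g ∈ L²(0, π)` is the weak derivative of `u ∈ L²(0, π)`. -/
def IsWeakDeriv (u g : L2Edge) : Prop :=
  ∀ φ : ℝ → ℝ, ContDiff ℝ ∞ φ → HasCompactSupport φ → tsupport φ ⊆ Set.Ioo 0 Real.pi →
    ∫ x in Set.Ioo 0 Real.pi, deriv φ x • u x = -∫ x in Set.Ioo 0 Real.pi, φ x • g x

/-- The continuous representative of `u` on `[0, π]` exists and takes the value `c` at `x`. -/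
def HasValueAt (u : L2Edge) (x : ℝ) (c : ℂ) : Prop :=
  ∃ f : ℝ → ℂ, ContinuousOn f (Set.Icc 0 Real.pi) ∧
    (∀ᵐ y ∂(volume.restrict (Set.Ioo (0 : ℝ) Real.pi)), u y = f y) ∧ f x = c

theorem integrable_edge (u : L2Edge) :
    Integrable u (volume.restrict (Set.Ioo (0 : ℝ) Real.pi)) :=
  (Lp.memLp u).integrable (by norm_num)

theorem integrable_smul_edge (u : L2Edge) {φ : ℝ → ℝ} (hφ : Continuous φ)
    (hc : HasCompactSupport φ) :
    Integrable (fun x => φ x • u x) (volume.restrict (Set.Ioo (0 : ℝ) Real.pi)) :=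
  (integrable_edge u).locallyIntegrable.integrable_smul_left_of_hasCompactSupport hφ hc

theorem IsWeakDeriv.add {u v g h : L2Edge} (hu : IsWeakDeriv u g) (hv : IsWeakDeriv v h) :
    IsWeakDeriv (u + v) (g + h) := by
  intro φ h1 h2 h3
  have hd : Continuous (deriv φ) := h1.continuous_deriv (by simp)
  have e1 : ∫ x in Set.Ioo 0 Real.pi, deriv φ x • (u + v : L2Edge) x =
      ∫ x in Set.Ioo 0 Real.pi, (deriv φ x • u x + deriv φ x • v x) := by
    refine integral_congr_ae ?_
    filter_upwards [Lp.coeFn_add u v] with x hx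
    rw [hx, Pi.add_apply, smul_add]
  have e2 : ∫ x in Set.Ioo 0 Real.pi, φ x • (g + h : L2Edge) x =
      ∫ x in Set.Ioo 0 Real.pi, (φ x • g x + φ x • h x) := by
    refine integral_congr_ae ?_
    filter_upwards [Lp.coeFn_add g h] with x hx
    rw [hx, Pi.add_apply, smul_add]
  rw [e1, e2, integral_add (integrable_smul_edge u hd h2.deriv)
    (integrable_smul_edge v hd h2.deriv), integral_add (integrable_smul_edge g h1.continuous h2)
    (integrable_smul_edge h h1.continuous h2), hu φ h1 h2 h3, hv φ h1 h2 h3, neg_add]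

theorem IsWeakDeriv.smul {u g : L2Edge} (c : ℂ) (hu : IsWeakDeriv u g) :
    IsWeakDeriv (c • u) (c • g) := by
  intro φ h1 h2 h3
  have e1 : ∫ x in Set.Ioo 0 Real.pi, deriv φ x • (c • u : L2Edge) x =
      ∫ x in Set.Ioo 0 Real.pi, c • (deriv φ x • u x) := by
    refine integral_congr_ae ?_
    filter_upwards [Lp.coeFn_smul c u] with x hx
    rw [hx, Pi.smul_apply, smul_comm]
  have e2 : ∫ x in Set.Ioo 0 Real.pi, φ x • (c • g : L2Edge) x =
      ∫ x in Set.Ioo 0 Real.pi, c • (φ x • g x) := by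
    refine integral_congr_ae ?_
    filter_upwards [Lp.coeFn_smul c g] with x hx
    rw [hx, Pi.smul_apply, smul_comm]
  rw [e1, e2, integral_smul, integral_smul, hu φ h1 h2 h3, smul_neg]

theorem IsWeakDeriv.zero : IsWeakDeriv 0 0 := by
  have h (φ : ℝ → ℝ) : ∫ x in Set.Ioo 0 Real.pi, φ x • (0 : L2Edge) x = 0 := by
    refine integral_eq_zero_of_ae ?_
    filter_upwards [Lp.coeFn_zero ℂ 2 (volume.restrict (Set.Ioo (0 : ℝ) Real.pi))] with x hx
    rw [hx]; simp
  intro φ _ _ _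
  rw [h, h, neg_zero]

theorem IsWeakDeriv.unique {u g h : L2Edge} (hg : IsWeakDeriv u g) (hh : IsWeakDeriv u h) :
    g = h := by
  have key : ∀ᵐ x ∂(volume : Measure ℝ), x ∈ Set.Ioo (0 : ℝ) Real.pi → g x - h x = 0 := by
    refine isOpen_Ioo.ae_eq_zero_of_integral_contDiff_smul_eq_zero (μ := volume) (f := fun x => g x - h x) ?_ ?_
    · have hi : IntegrableOn (fun x => g x - h x) (Set.Ioo (0 : ℝ) Real.pi) volume :=
        (integrable_edge g).sub (integrable_edge h)
      exact hi.locallyIntegrableOn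
    · intro φ h1 h2 h3
      have e0 : ∫ x, φ x • (g x - h x) = ∫ x in Set.Ioo 0 Real.pi, φ x • (g x - h x) := by
        refine (setIntegral_eq_integral_of_forall_compl_eq_zero fun x hx => ?_).symm
        rw [image_eq_zero_of_notMem_tsupport fun hx' => hx (h3 hx'), zero_smul]
      rw [e0]
      simp only [smul_sub]
      rw [integral_sub (integrable_smul_edge g h1.continuous h2)
        (integrable_smul_edge h h1.continuous h2), sub_eq_zero]
      exact neg_injective ((hg φ h1 h2 h3).symm.trans (hh φ h1 h2 h3))
  refine Lp.ext ?_
  rw [Filter.EventuallyEq, ae_restrict_iff' measurableSet_Ioo]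
  filter_upwards [key] with x hx hx'
  exact sub_eq_zero.mp (hx hx')

theorem HasValueAt.add {u v : L2Edge} {x : ℝ} {c d : ℂ} (hu : HasValueAt u x c)
    (hv : HasValueAt v x d) : HasValueAt (u + v) x (c + d) := by
  obtain ⟨f, f1, f2, f3⟩ := hu
  obtain ⟨k, k1, k2, k3⟩ := hv
  refine ⟨fun y => f y + k y, f1.add k1, ?_, by simp only [f3, k3]⟩
  filter_upwards [Lp.coeFn_add u v, f2, k2] with y h1 h2 h3
  rw [h1, Pi.add_apply, h2, h3]

theorem HasValueAt.smul {u : L2Edge} {x : ℝ} {c : ℂ} (a : ℂ) (hu : HasValueAt u x c) :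
    HasValueAt (a • u) x (a * c) := by
  obtain ⟨f, f1, f2, f3⟩ := hu
  refine ⟨fun y => a * f y, continuousOn_const.mul f1, ?_, by simp only [f3]⟩
  filter_upwards [Lp.coeFn_smul a u, f2] with y h1 h2
  rw [h1, Pi.smul_apply, h2, smul_eq_mul]

theorem HasValueAt.zero (x : ℝ) : HasValueAt 0 x 0 := by
  refine ⟨fun _ => 0, continuousOn_const, ?_, rfl⟩
  filter_upwards [Lp.coeFn_zero ℂ 2 (volume.restrict (Set.Ioo (0 : ℝ) Real.pi))] with y h1
  rw [h1, Pi.zero_apply]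

/-- The weak derivative `u ↦ u'` as an operator in `L²(0, π)` with domain `H¹(0, π)`. -/
def weakD : L2Edge →ₗ.[ℂ] L2Edge where
  domain :=
    { carrier := {u | ∃ g, IsWeakDeriv u g}
      zero_mem' := ⟨0, IsWeakDeriv.zero⟩
      add_mem' := by
        rintro u v ⟨g, hg⟩ ⟨h, hh⟩
        exact ⟨g + h, hg.add hh⟩
      smul_mem' := by
        rintro c u ⟨g, hg⟩
        exact ⟨c • g, hg.smul c⟩ }
  toFun :=
    { toFun := fun u => u.2.choose
      map_add' := fun u v =>
        (u + v).2.choose_spec.unique (u.2.choose_spec.add v.2.choose_spec)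
      map_smul' := fun c u => (c • u).2.choose_spec.unique (u.2.choose_spec.smul c) }

theorem weakD_spec (u : weakD.domain) : IsWeakDeriv u (weakD u) := u.2.choose_spec

/-- The second weak derivative `u ↦ u''`, with domain `H²(0, π)`. -/
def weakD2 : L2Edge →ₗ.[ℂ] L2Edge := PartialOp.pcomp weakD weakD

/-! ### The star graph with `n` edges of length `π`

Every edge is a copy of `(0, π)`; the endpoint `0` is the common central vertex. -/

/-- `L²(Γ) = (L²(0, π))ⁿ`. -/
abbrev L2Star (n : ℕ) : Type := PiLp 2 (fun _ : Fin n => L2Edge)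

/-- The space `H¹₀(Γ)`: components in `H¹(0, π)` that vanish at `π` and share their value at the
central vertex. -/
def H10Star (n : ℕ) : Submodule ℂ (L2Star n) where
  carrier := {u | (∀ j, u j ∈ weakD.domain) ∧ (∀ j, HasValueAt (u j) Real.pi 0) ∧
    ∃ c : ℂ, ∀ j, HasValueAt (u j) 0 c}
  zero_mem' := ⟨fun _ => weakD.domain.zero_mem, fun _ => HasValueAt.zero _,
    0, fun _ => HasValueAt.zero _⟩
  add_mem' := by
    rintro u v ⟨hu1, hu2, c, hu3⟩ ⟨hv1, hv2, d, hv3⟩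
    refine ⟨fun j => weakD.domain.add_mem (hu1 j) (hv1 j), fun j => ?_,
      c + d, fun j => (hu3 j).add (hv3 j)⟩
    have := (hu2 j).add (hv2 j)
    rwa [add_zero] at this
  smul_mem' := by
    rintro a u ⟨hu1, hu2, c, hu3⟩
    refine ⟨fun j => weakD.domain.smul_mem a (hu1 j), fun j => ?_,
      a * c, fun j => (hu3 j).smul a⟩
    have := (hu2 j).smul a
    rwa [mul_zero] at this

/-- The underlying vector space of the energy space `H¹₀(Γ) × L²(Γ)`. -/
abbrev Energy (n : ℕ) : Type := H10Star n × L2Star n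

/-- The vertex condition `∑ j, u_j'(0) = α v(0)`. -/
def VertexCondition {n : ℕ} (α : ℂ) (u v : L2Star n) : Prop :=
  ∃ (c : Fin n → ℂ) (d : ℂ),
    (∀ j, ∃ g, IsWeakDeriv (u j) g ∧ HasValueAt g 0 (c j)) ∧
    (∀ j, HasValueAt (v j) 0 d) ∧ ∑ j, c j = α * d

/-- The wave operator `A_n(α) (u, v) = (v, u'')` with Dirac damping `α` at the central vertex,
whose domain consists of the `(u, v) ∈ (H¹₀(Γ) ∩ H²(Γ*)) × H¹₀(Γ)` that satisfy the vertex
condition. -/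
def waveOp (n : ℕ) (α : ℂ) : Energy n →ₗ.[ℂ] Energy n where
  domain :=
    { carrier := {ψ | (∀ j, (ψ.1 : L2Star n) j ∈ weakD2.domain) ∧ ψ.2 ∈ H10Star n ∧
        VertexCondition α (ψ.1 : L2Star n) ψ.2}
      zero_mem' := by
        refine ⟨fun _ => weakD2.domain.zero_mem, (H10Star n).zero_mem, 0, 0,
          fun _ => ⟨0, IsWeakDeriv.zero, HasValueAt.zero _⟩, fun _ => HasValueAt.zero _, by simp⟩
      add_mem' := by
        rintro ψ χ ⟨h1, h2, c, d, h3, h4, h5⟩ ⟨k1, k2, c', d', k3, k4, k5⟩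
        refine ⟨fun j => weakD2.domain.add_mem (h1 j) (k1 j), (H10Star n).add_mem h2 k2,
          c + c', d + d', fun j => ?_, fun j => (h4 j).add (k4 j), ?_⟩
        · obtain ⟨g, g1, g2⟩ := h3 j
          obtain ⟨g', g1', g2'⟩ := k3 j
          exact ⟨g + g', g1.add g1', g2.add g2'⟩
        · simp only [Pi.add_apply, Finset.sum_add_distrib, h5, k5, mul_add]
      smul_mem' := by
        rintro a ψ ⟨h1, h2, c, d, h3, h4, h5⟩
        refine ⟨fun j => weakD2.domain.smul_mem a (h1 j), (H10Star n).smul_mem a h2,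
          fun j => a * c j, a * d, fun j => ?_, fun j => (h4 j).smul a, ?_⟩
        · obtain ⟨g, g1, g2⟩ := h3 j
          exact ⟨a • g, g1.smul a, g2.smul a⟩
        · rw [← Finset.mul_sum, h5]; ring }
  toFun :=
    { toFun := fun ψ => (⟨ψ.1.2, ψ.2.2.1⟩,
        WithLp.toLp 2 fun j => weakD2 ⟨(ψ.1.1 : L2Star n) j, ψ.2.1 j⟩)
      map_add' := by
        intro ψ χ
        refine Prod.ext (Subtype.ext rfl) (PiLp.ext fun j => ?_)
        exact weakD2.map_add ⟨(ψ.1.1 : L2Star n) j, ψ.2.1 j⟩ ⟨(χ.1.1 : L2Star n) j, χ.2.1 j⟩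
      map_smul' := by
        intro a ψ
        refine Prod.ext (Subtype.ext rfl) (PiLp.ext fun j => ?_)
        exact weakD2.map_smul a ⟨(ψ.1.1 : L2Star n) j, ψ.2.1 j⟩ }

/-- The characteristic function `S_n(l; α) = sinh(lπ) (n cosh(lπ) + α sinh(lπ)) / l`, with its
removable singularity at `l = 0` filled in by the limit `n π`. -/
def charFun (n : ℕ) (α l : ℂ) : ℂ :=
  if l = 0 then n * Real.pi
  else Complex.sinh (l * Real.pi) / l *
    (n * Complex.cosh (l * Real.pi) + α * Complex.sinh (l * Real.pi))

end StarGraph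

end

/-!
On each edge the equation `A_n(α) (u, v) = l (u, v)` says `v = l u` and `u'' = l² u` with
`u(π) = 0`. A weak solution is a classical one (`IsWeakDeriv.exists_hasDerivAt`, which rests on
the lemma of du Bois-Reymond), so for `l ≠ 0` the components are `u_j(x) = b_j sinh(l (π - x))`.
Continuity at the vertex reads `b_j sinh(l π) = d` for all `j`, and the vertex condition reads
`(∑ b_j) cosh(l π) = -α d`. These have a nonzero solution `b` exactly when `sinh(l π) = 0`
(here `n ≥ 2` enters: two edges carry opposite waves) or `n cosh(l π) + α sinh(l π) = 0`, that is,
when `charFun n α l = 0`. For `l = 0` the solutions are `b_j (π - x)` with all `b_j` equal to some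
`b` and `n b = 0`, so `0` is neither an eigenvalue nor a zero.

All zeros of the characteristic function are simple: a common zero of
`n cosh z + α sinh z` and of `sinh z`, or of its derivative `n sinh z + α cosh z`, contradicts
`cosh² z - sinh² z = 1` (`sinh_add_cosh_ne_zero`, `analyticOrderAt_charFun`). It therefore remains
to see that the index is one, i.e. that there is no Jordan chain of length two
(`PartialOp.IsEigenvalue.isIndex_one`, `eq_zero_of_jordan_chain`). If
`A_n(α) ψ = l ψ + χ` with an eigenvector `χ` of amplitudes `c_j`, then each edge solves the
resonant equation `u'' = l² u + 2 l c_j sinh(l (π - x))`, whose solutions contain the secular term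
`c_j (π - x) cosh(l (π - x))`. Its contribution `c_j π cosh(l π)` to the value and
`-c_j l π sinh(l π)` to the derivative at the vertex turn the vertex conditions into the
statement that either `c = 0` or the derivative of the vanishing factor vanishes as well.
-/

noncomputable section
namespace StarGraph

/-! ### The fundamental lemma of the calculus of variations and integration by parts -/

/-- A smooth function of mean zero with compact support in `(0, π)` is the derivative of a
test function on `(0, π)`. -/
theorem exists_testFunction_deriv_eq {χ : ℝ → ℝ} (hχ : ContDiff ℝ ∞ χ) {K : Set ℝ}
    (hK : IsCompact K) (hne : K.Nonempty) (hKs : K ⊆ Set.Ioo 0 Real.pi)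
    (hsupp : ∀ x ∉ K, χ x = 0) (hint : ∫ x, χ x = 0) :
    ∃ Φ : ℝ → ℝ, ContDiff ℝ ∞ Φ ∧ HasCompactSupport Φ ∧ tsupport Φ ⊆ Set.Ioo 0 Real.pi ∧
      deriv Φ = χ := by
  obtain ⟨a, haK, ha⟩ := hK.exists_isLeast hne
  obtain ⟨b, hbK, hb⟩ := hK.exists_isGreatest hne
  have hd : ∀ x, HasDerivAt (fun y => ∫ t in (0 : ℝ)..y, χ t) (χ x) x := fun x =>
    intervalIntegral.integral_hasDerivAt_right (hχ.continuous.intervalIntegrable _ _)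
      (hχ.continuous.stronglyMeasurableAtFilter _ _) hχ.continuous.continuousAt
  have hderiv : deriv (fun y => ∫ t in (0 : ℝ)..y, χ t) = χ := funext fun x => (hd x).deriv
  have hzero : ∀ x ∉ Set.Icc a b, ∫ t in (0 : ℝ)..x, χ t = 0 := by
    intro x hx
    rw [Set.mem_Icc, not_and_or, not_le, not_le] at hx
    rcases hx with hx | hx
    · refine intervalIntegral.integral_zero_ae (Filter.Eventually.of_forall fun t ht => ?_)
      refine hsupp t fun htK => ?_
      have h1 := ha htK
      have h2 : t ≤ max 0 x := (Set.mem_Ioc.mp ht).2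
      have h3 := (hKs haK).1
      rcases le_max_iff.mp h2 with h | h <;> linarith
    · rw [intervalIntegral.integral_eq_integral_of_support_subset, hint]
      intro t ht
      have htK : t ∈ K := by
        by_contra h
        exact ht (hsupp t h)
      exact ⟨(hKs htK).1, (hb htK).trans hx.le⟩
  have hts : tsupport (fun y => ∫ t in (0 : ℝ)..y, χ t) ⊆ Set.Icc a b := by
    refine closure_minimal (fun x hx => ?_) isClosed_Icc
    by_contra h
    exact hx (hzero x h)
  refine ⟨_, contDiff_infty_iff_deriv.mpr ⟨fun x => (hd x).differentiableAt, by rwa [hderiv]⟩,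
    isCompact_Icc.of_isClosed_subset (isClosed_tsupport _) hts, hts.trans fun x hx => ?_, hderiv⟩
  exact ⟨(hKs haK).1.trans_le hx.1, hx.2.trans_lt (hKs hbK).2⟩

/-- The lemma of du Bois-Reymond: an integrable function with vanishing weak derivative is
almost everywhere constant. -/
theorem ae_eq_const_of_weakDeriv_zero {w : ℝ → ℂ}
    (hw : IntegrableOn w (Set.Ioo 0 Real.pi))
    (h : ∀ φ : ℝ → ℝ, ContDiff ℝ ∞ φ → HasCompactSupport φ → tsupport φ ⊆ Set.Ioo 0 Real.pi →
      ∫ x in Set.Ioo 0 Real.pi, deriv φ x • w x = 0) :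
    ∃ C : ℂ, ∀ᵐ x ∂(volume.restrict (Set.Ioo (0 : ℝ) Real.pi)), w x = C := by
  have hpi := Real.pi_pos
  -- a fixed weight of integral one, used to project test functions to those of mean zero
  let B : ContDiffBump (Real.pi / 2) := ⟨Real.pi / 8, Real.pi / 4, by positivity, by linarith⟩
  have hBs : tsupport (B.normed volume) ⊆ Set.Ioo 0 Real.pi := by
    rw [B.tsupport_normed_eq]
    intro x hx
    rw [Metric.mem_closedBall, Real.dist_eq, abs_le] at hx
    have : B.rOut = Real.pi / 4 := rfl
    rw [this] at hx
    constructor <;> linarith [hx.1, hx.2]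
  have hBc : HasCompactSupport (B.normed volume) := B.hasCompactSupport_normed
  have hBd : ContDiff ℝ ∞ (B.normed volume) := B.contDiff_normed
  have hsm : ∀ φ : ℝ → ℝ, Continuous φ → HasCompactSupport φ →
      Integrable (fun x => φ x • w x) (volume.restrict (Set.Ioo (0 : ℝ) Real.pi)) :=
    fun φ h1 h2 => hw.locallyIntegrable.integrable_smul_left_of_hasCompactSupport h1 h2
  set C : ℂ := ∫ x in Set.Ioo 0 Real.pi, B.normed volume x • w x with hC
  refine ⟨C, ?_⟩
  have key : ∀ᵐ x ∂(volume : Measure ℝ), x ∈ Set.Ioo (0 : ℝ) Real.pi → w x - C = 0 := by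
    have hwC : IntegrableOn (fun x => w x - C) (Set.Ioo (0 : ℝ) Real.pi) volume :=
      hw.sub (integrableOn_const (by simp))
    refine isOpen_Ioo.ae_eq_zero_of_integral_contDiff_smul_eq_zero (μ := volume)
      (f := fun x => w x - C) hwC.locallyIntegrableOn ?_
    intro ψ h1 h2 h3
    have e0 : ∫ x, ψ x • (w x - C) = ∫ x in Set.Ioo 0 Real.pi, ψ x • (w x - C) := by
      refine (setIntegral_eq_integral_of_forall_compl_eq_zero fun x hx => ?_).symm
      rw [image_eq_zero_of_notMem_tsupport fun hx' => hx (h3 hx'), zero_smul]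
    set a : ℝ := ∫ x, ψ x with ha
    have ea : ∫ x in Set.Ioo 0 Real.pi, ψ x = a := by
      refine setIntegral_eq_integral_of_forall_compl_eq_zero fun x hx => ?_
      exact image_eq_zero_of_notMem_tsupport fun hx' => hx (h3 hx')
    obtain ⟨Φ, f1, f2, f3, f4⟩ := exists_testFunction_deriv_eq
      (χ := fun x => ψ x - a * B.normed volume x) (h1.sub (contDiff_const.mul hBd))
      (K := tsupport ψ ∪ tsupport (B.normed volume)) (h2.isCompact.union hBc.isCompact)
      (by
        refine ⟨Real.pi / 2, Or.inr ?_⟩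
        rw [B.tsupport_normed_eq]
        exact Metric.mem_closedBall_self B.rOut_pos.le)
      (Set.union_subset h3 hBs)
      (by
        intro x hx
        rw [Set.mem_union, not_or] at hx
        simp only [image_eq_zero_of_notMem_tsupport hx.1, image_eq_zero_of_notMem_tsupport hx.2,
          mul_zero, sub_zero])
      (by
        rw [integral_sub (h1.continuous.integrable_of_hasCompactSupport h2)
          ((hBd.continuous.integrable_of_hasCompactSupport hBc).const_mul a),
          integral_const_mul, B.integral_normed, mul_one, sub_self])
    have hΦ := h Φ f1 f2 f3
    rw [f4] at hΦ
    have e1 : ∫ x in Set.Ioo 0 Real.pi, (ψ x - a * B.normed volume x) • w x =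
        (∫ x in Set.Ioo 0 Real.pi, ψ x • w x) - a • C := by
      simp only [sub_smul, mul_smul]
      rw [integral_sub (g := fun x => a • B.normed volume x • w x) (hsm ψ h1.continuous h2)
        ((hsm _ hBd.continuous hBc).smul a), integral_smul]
    have e2 : ∫ x in Set.Ioo 0 Real.pi, ψ x • (w x - C) =
        (∫ x in Set.Ioo 0 Real.pi, ψ x • w x) - a • C := by
      simp only [smul_sub]
      rw [integral_sub (hsm ψ h1.continuous h2)
        ((h1.continuous.integrable_of_hasCompactSupport h2).integrableOn.smul_const C),
        integral_smul_const, ea]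
    rw [e0, e2, ← e1, hΦ]
  rw [ae_restrict_iff' measurableSet_Ioo]
  filter_upwards [key] with x hx hx'
  exact sub_eq_zero.mp (hx hx')

/-- Integration by parts of a test function against the primitive of an integrable function. -/
theorem integral_deriv_mul_primitive_real {g : ℝ → ℝ} (hg : IntervalIntegrable g volume 0 Real.pi)
    {φ : ℝ → ℝ} (h1 : ContDiff ℝ ∞ φ) (h3 : tsupport φ ⊆ Set.Ioo 0 Real.pi) :
    ∫ x in (0 : ℝ)..Real.pi, deriv φ x * ∫ t in (0 : ℝ)..x, g t =
      -∫ x in (0 : ℝ)..Real.pi, φ x * g x := by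
  have hF := hg.absolutelyContinuousOnInterval_intervalIntegral (c := 0) (by simp)
  have hφ : AbsolutelyContinuousOnInterval φ 0 Real.pi :=
    (h1.of_le (by exact_mod_cast le_top)).contDiffOn.absolutelyContinuousOnInterval
  have h := hφ.integral_mul_deriv_eq_deriv_mul hF
  have e0 : φ 0 = 0 := image_eq_zero_of_notMem_tsupport fun h => lt_irrefl _ (h3 h).1
  have e1 : φ Real.pi = 0 := image_eq_zero_of_notMem_tsupport fun h => lt_irrefl _ (h3 h).2
  have e2 : ∫ x in (0 : ℝ)..Real.pi, φ x * deriv (fun y => ∫ t in (0 : ℝ)..y, g t) x =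
      ∫ x in (0 : ℝ)..Real.pi, φ x * g x := by
    refine intervalIntegral.integral_congr_ae ?_
    filter_upwards [hg.ae_hasDerivAt_integral] with x hx hx'
    rw [(hx (Set.uIoc_subset_uIcc hx') 0 (by simp)).deriv]
  rw [e2, e0, e1] at h
  rw [h]; ring

theorem integral_deriv_smul_primitive {g : ℝ → ℂ} (hg : IntervalIntegrable g volume 0 Real.pi)
    {φ : ℝ → ℝ} (h1 : ContDiff ℝ ∞ φ) (h3 : tsupport φ ⊆ Set.Ioo 0 Real.pi) :
    ∫ x in (0 : ℝ)..Real.pi, deriv φ x • ∫ t in (0 : ℝ)..x, g t =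
      -∫ x in (0 : ℝ)..Real.pi, φ x • g x := by
  have hd : Continuous (deriv φ) := h1.continuous_deriv (by simp)
  have hFc : ContinuousOn (fun x => ∫ t in (0 : ℝ)..x, g t) (Set.uIcc 0 Real.pi) :=
    intervalIntegral.continuousOn_primitive_interval' hg (by simp)
  have i1 : IntervalIntegrable (fun x => deriv φ x • ∫ t in (0 : ℝ)..x, g t) volume 0 Real.pi :=
    (hd.continuousOn.smul hFc).intervalIntegrable
  have i2 : IntervalIntegrable (fun x => φ x • g x) volume 0 Real.pi :=
    hg.continuousOn_smul h1.continuous.continuousOn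
  -- the real and the imaginary part are two instances of the real statement
  have hL : ∀ L : ℂ →L[ℝ] ℝ,
      L (∫ x in (0 : ℝ)..Real.pi, deriv φ x • ∫ t in (0 : ℝ)..x, g t) =
        L (-∫ x in (0 : ℝ)..Real.pi, φ x • g x) := by
    intro L
    have hLg : IntervalIntegrable (fun x => L (g x)) volume 0 Real.pi :=
      ⟨L.integrable_comp hg.1, L.integrable_comp hg.2⟩
    rw [map_neg, ← L.intervalIntegral_comp_comm i1, ← L.intervalIntegral_comp_comm i2]
    simp only [map_smul, smul_eq_mul]
    rw [← integral_deriv_mul_primitive_real hLg h1 h3]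
    refine intervalIntegral.integral_congr fun x hx => ?_
    have hsub : IntervalIntegrable g volume 0 x :=
      hg.mono_set (Set.uIcc_subset_uIcc (by simp) hx)
    simp only [L.intervalIntegral_comp_comm hsub]
  exact Complex.ext (hL Complex.reCLM) (hL Complex.imCLM)

theorem intervalIntegrable_edge (u : L2Edge) : IntervalIntegrable u volume 0 Real.pi := by
  rw [intervalIntegrable_iff_integrableOn_Ioo_of_le Real.pi_pos.le]
  exact integrable_edge u

theorem setIntegral_Ioo_eq (f : ℝ → ℂ) :
    ∫ x in Set.Ioo 0 Real.pi, f x = ∫ x in (0 : ℝ)..Real.pi, f x := by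
  rw [intervalIntegral.integral_of_le Real.pi_pos.le, integral_Ioc_eq_integral_Ioo]

/-! ### Sobolev functions on the interval and their continuous representatives -/

/-- A function in `H¹(0, π)` is a primitive of its weak derivative. -/
theorem IsWeakDeriv.exists_primitive {u g : L2Edge} (h : IsWeakDeriv u g) :
    ∃ C : ℂ, ∀ᵐ x ∂(volume.restrict (Set.Ioo (0 : ℝ) Real.pi)),
      u x = C + ∫ t in (0 : ℝ)..x, g t := by
  have hg := intervalIntegrable_edge g
  have hFc : ContinuousOn (fun x => ∫ t in (0 : ℝ)..x, g t) (Set.Icc 0 Real.pi) := by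
    have := intervalIntegral.continuousOn_primitive_interval' hg (a := 0) (by simp)
    rwa [Set.uIcc_of_le Real.pi_pos.le] at this
  have hFi : IntegrableOn (fun x => ∫ t in (0 : ℝ)..x, g t) (Set.Ioo 0 Real.pi) :=
    hFc.integrableOn_Icc.mono_set Set.Ioo_subset_Icc_self
  obtain ⟨C, hC⟩ := ae_eq_const_of_weakDeriv_zero (w := fun x => u x - ∫ t in (0 : ℝ)..x, g t)
    ((integrable_edge u).sub hFi) (by
      intro φ h1 h2 h3
      have hd : Continuous (deriv φ) := h1.continuous_deriv (by simp)
      simp only [smul_sub]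
      rw [integral_sub (integrable_smul_edge u hd h2.deriv)
        (hFi.locallyIntegrable.integrable_smul_left_of_hasCompactSupport hd h2.deriv),
        h φ h1 h2 h3, setIntegral_Ioo_eq, setIntegral_Ioo_eq,
        integral_deriv_smul_primitive hg h1 h3, sub_self])
  refine ⟨C, ?_⟩
  filter_upwards [hC] with x hx
  rw [← hx]; ring

/-- If the weak derivative has a continuous representative `k`, the function has a representative
that is differentiable with derivative `k`. -/
theorem IsWeakDeriv.exists_hasDerivAt {u g : L2Edge} (h : IsWeakDeriv u g) {k : ℝ → ℂ}
    (hk : ContinuousOn k (Set.Icc 0 Real.pi))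
    (hgk : ∀ᵐ x ∂(volume.restrict (Set.Ioo (0 : ℝ) Real.pi)), g x = k x) :
    ∃ f : ℝ → ℂ, ContinuousOn f (Set.Icc 0 Real.pi) ∧
      (∀ᵐ x ∂(volume.restrict (Set.Ioo (0 : ℝ) Real.pi)), u x = f x) ∧
      ∀ x ∈ Set.Ioo 0 Real.pi, HasDerivAt f (k x) x := by
  obtain ⟨C, hC⟩ := h.exists_primitive
  have hki : IntervalIntegrable k volume 0 Real.pi :=
    hk.intervalIntegrable_of_Icc Real.pi_pos.le
  have hFc : ContinuousOn (fun x => ∫ t in (0 : ℝ)..x, k t) (Set.Icc 0 Real.pi) := by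
    have := intervalIntegral.continuousOn_primitive_interval' hki (a := 0) (by simp)
    rwa [Set.uIcc_of_le Real.pi_pos.le] at this
  refine ⟨fun x => C + ∫ t in (0 : ℝ)..x, k t, continuousOn_const.add hFc, ?_, fun x hx => ?_⟩
  · rw [ae_restrict_iff' measurableSet_Ioo] at hgk
    filter_upwards [hC, ae_restrict_mem measurableSet_Ioo] with x hx hx'
    rw [hx]
    congr 1
    refine intervalIntegral.integral_congr_ae ?_
    filter_upwards [hgk] with t ht ht'
    rw [Set.uIoc_of_le hx'.1.le] at ht'
    exact ht ⟨ht'.1, ht'.2.trans_lt hx'.2⟩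
  · have hn : Set.Icc 0 Real.pi ∈ nhds x := Icc_mem_nhds hx.1 hx.2
    refine (intervalIntegral.integral_hasDerivAt_right ?_ ?_ (hk.continuousAt hn)).const_add C
    · exact hki.mono_set (Set.uIcc_subset_uIcc (by simp)
        (by rw [Set.uIcc_of_le Real.pi_pos.le]; exact ⟨hx.1.le, hx.2.le⟩))
    · exact (hk.mono Set.Ioo_subset_Icc_self).stronglyMeasurableAtFilter isOpen_Ioo x hx

/-- A classical derivative is a weak derivative. -/
theorem isWeakDeriv_of_hasDerivAt {u g : L2Edge} {f k : ℝ → ℂ} (hf : ∀ x, HasDerivAt f (k x) x)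
    (hk : Continuous k)
    (huf : ∀ᵐ x ∂(volume.restrict (Set.Ioo (0 : ℝ) Real.pi)), u x = f x)
    (hgk : ∀ᵐ x ∂(volume.restrict (Set.Ioo (0 : ℝ) Real.pi)), g x = k x) :
    IsWeakDeriv u g := by
  intro φ h1 h2 h3
  have hd : Continuous (deriv φ) := h1.continuous_deriv (by simp)
  have e1 : ∫ x in Set.Ioo 0 Real.pi, deriv φ x • u x =
      ∫ x in Set.Ioo 0 Real.pi, deriv φ x • f x :=
    integral_congr_ae (by filter_upwards [huf] with x hx; rw [hx])
  have e2 : ∫ x in Set.Ioo 0 Real.pi, φ x • g x = ∫ x in Set.Ioo 0 Real.pi, φ x • k x :=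
    integral_congr_ae (by filter_upwards [hgk] with x hx; rw [hx])
  have e3 : φ 0 = 0 := image_eq_zero_of_notMem_tsupport fun h => lt_irrefl _ (h3 h).1
  have e4 : φ Real.pi = 0 := image_eq_zero_of_notMem_tsupport fun h => lt_irrefl _ (h3 h).2
  have hφ : ∀ x, HasDerivAt φ (deriv φ x) x := fun x =>
    ((h1.differentiable (by simp)) x).hasDerivAt
  have := intervalIntegral.integral_smul_deriv_eq_deriv_smul (a := 0) (b := Real.pi)
    (fun x _ => hφ x) (fun x _ => hf x) (hd.intervalIntegrable _ _) (hk.intervalIntegrable _ _)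
  rw [e3, e4, zero_smul, zero_smul] at this
  rw [e1, e2, setIntegral_Ioo_eq, setIntegral_Ioo_eq, this]
  simp

theorem eqOn_of_ae_eq_edge {f k : ℝ → ℂ} (hf : ContinuousOn f (Set.Icc 0 Real.pi))
    (hk : ContinuousOn k (Set.Icc 0 Real.pi))
    (h : ∀ᵐ x ∂(volume.restrict (Set.Ioo (0 : ℝ) Real.pi)), f x = k x) :
    Set.EqOn f k (Set.Icc 0 Real.pi) := by
  refine Measure.eqOn_Icc_of_ae_eq (μ := volume) Real.pi_pos.ne ?_ hf hk
  rw [← restrict_Ioo_eq_restrict_Icc]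
  exact h

theorem HasValueAt.eq_of_ae_eq {u : L2Edge} {x : ℝ} {c : ℂ} (h : HasValueAt u x c)
    (hx : x ∈ Set.Icc 0 Real.pi) {f : ℝ → ℂ} (hf : ContinuousOn f (Set.Icc 0 Real.pi))
    (huf : ∀ᵐ y ∂(volume.restrict (Set.Ioo (0 : ℝ) Real.pi)), u y = f y) : c = f x := by
  obtain ⟨k, k1, k2, k3⟩ := h
  rw [← k3]
  refine eqOn_of_ae_eq_edge k1 hf ?_ hx
  filter_upwards [k2, huf] with y h1 h2
  rw [← h1, h2]

theorem HasValueAt.unique {u : L2Edge} {x : ℝ} {c d : ℂ} (hc : HasValueAt u x c)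
    (hd : HasValueAt u x d) (hx : x ∈ Set.Icc 0 Real.pi) : c = d := by
  obtain ⟨f, f1, f2, f3⟩ := hd
  rw [← f3]
  exact hc.eq_of_ae_eq hx f1 f2

/-! ### The differential equation on one edge -/

theorem eq_right_of_hasDerivAt_zero {F : ℝ → ℂ} (hF : ContinuousOn F (Set.Icc 0 Real.pi))
    (hd : ∀ x ∈ Set.Ioo 0 Real.pi, HasDerivAt F 0 x) {x : ℝ} (hx : x ∈ Set.Icc 0 Real.pi) :
    F x = F Real.pi := by
  have h := intervalIntegral.integral_eq_sub_of_hasDerivAt_of_le (f := F) (f' := fun _ => 0) hx.2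
    (hF.mono (Set.Icc_subset_Icc_left hx.1))
    (fun y hy => hd y ⟨hx.1.trans_lt hy.1, hy.2⟩) (by simp)
  rw [intervalIntegral.integral_zero] at h
  exact (sub_eq_zero.mp h.symm).symm

theorem hasDerivAt_exp_mul_ofReal (a : ℂ) (x : ℝ) :
    HasDerivAt (fun y : ℝ => Complex.exp (a * y)) (Complex.exp (a * x) * a) x := by
  have := ((Complex.ofRealCLM.hasDerivAt (x := x)).const_mul a).cexp
  simpa using this

/-- Uniqueness for `f'' = l² f` with vanishing Cauchy data at `π`. -/
theorem eq_zero_of_hasDerivAt_of_right {l : ℂ} {f k : ℝ → ℂ}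
    (hf : ContinuousOn f (Set.Icc 0 Real.pi)) (hk : ContinuousOn k (Set.Icc 0 Real.pi))
    (hfd : ∀ x ∈ Set.Ioo 0 Real.pi, HasDerivAt f (k x) x)
    (hkd : ∀ x ∈ Set.Ioo 0 Real.pi, HasDerivAt k (l ^ 2 * f x) x)
    (hf0 : f Real.pi = 0) (hk0 : k Real.pi = 0) {x : ℝ} (hx : x ∈ Set.Icc 0 Real.pi) :
    f x = 0 ∧ k x = 0 := by
  have hec : ∀ a : ℂ, ContinuousOn (fun y : ℝ => Complex.exp (a * y)) (Set.Icc 0 Real.pi) :=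
    fun a => Continuous.continuousOn (by fun_prop)
  -- the equation factors as `(d/dx - l) (d/dx + l) f = 0`
  have h1 : ∀ x ∈ Set.Icc 0 Real.pi, k x + l * f x = 0 := by
    intro x hx
    have h := eq_right_of_hasDerivAt_zero
      (F := fun y => (k y + l * f y) * Complex.exp (-l * y))
      ((hk.add (continuousOn_const.mul hf)).mul (hec _)) (fun y hy => by
        have := ((hkd y hy).add ((hfd y hy).const_mul l)).mul (hasDerivAt_exp_mul_ofReal (-l) y)
        refine this.congr_deriv ?_
        simp only [Pi.add_apply]; ring) hx
    simpa [hf0, hk0, Complex.exp_ne_zero] using h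
  have h2 : f x = 0 := by
    have h := eq_right_of_hasDerivAt_zero
      (F := fun y => f y * Complex.exp (l * y)) (hf.mul (hec _)) (fun y hy => by
        have := (hfd y hy).mul (hasDerivAt_exp_mul_ofReal l y)
        refine this.congr_deriv ?_
        have h0 := h1 y ⟨hy.1.le, hy.2.le⟩
        linear_combination Complex.exp (l * y) * h0) hx
    simpa [hf0, Complex.exp_ne_zero] using h
  refine ⟨h2, ?_⟩
  have := h1 x hx
  rwa [h2, mul_zero, add_zero] at this

theorem hasDerivAt_reflect (l : ℂ) (x : ℝ) :
    HasDerivAt (fun y : ℝ => l * ((Real.pi : ℂ) - y)) (-l) x := by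
  have := ((Complex.ofRealCLM.hasDerivAt (x := x)).const_sub (Real.pi : ℂ)).const_mul l
  simpa using this

theorem hasDerivAt_sinh_reflect (l : ℂ) (x : ℝ) :
    HasDerivAt (fun y : ℝ => Complex.sinh (l * ((Real.pi : ℂ) - y)))
      (-l * Complex.cosh (l * ((Real.pi : ℂ) - x))) x := by
  refine ((Complex.hasDerivAt_sinh _).comp x (hasDerivAt_reflect l x)).congr_deriv ?_
  ring

theorem hasDerivAt_cosh_reflect (l : ℂ) (x : ℝ) :
    HasDerivAt (fun y : ℝ => Complex.cosh (l * ((Real.pi : ℂ) - y)))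
      (-l * Complex.sinh (l * ((Real.pi : ℂ) - x))) x := by
  refine ((Complex.hasDerivAt_cosh _).comp x (hasDerivAt_reflect l x)).congr_deriv ?_
  ring

/-- The solutions of `f'' = l² f + 2 l c sinh(l (π - x))` with `f(π) = 0`, for `l ≠ 0`.
The inhomogeneity is resonant, whence the secular term `(π - x) cosh(l (π - x))`. -/
theorem exists_eq_of_hasDerivAt {l c : ℂ} (hl : l ≠ 0) {f k : ℝ → ℂ}
    (hf : ContinuousOn f (Set.Icc 0 Real.pi)) (hk : ContinuousOn k (Set.Icc 0 Real.pi))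
    (hfd : ∀ x ∈ Set.Ioo 0 Real.pi, HasDerivAt f (k x) x)
    (hkd : ∀ x ∈ Set.Ioo 0 Real.pi, HasDerivAt k
      (l ^ 2 * f x + 2 * l * c * Complex.sinh (l * ((Real.pi : ℂ) - x))) x)
    (hf0 : f Real.pi = 0) :
    ∃ b : ℂ, ∀ x ∈ Set.Icc 0 Real.pi,
      f x = b * Complex.sinh (l * ((Real.pi : ℂ) - x)) +
        c * (((Real.pi : ℂ) - x) * Complex.cosh (l * ((Real.pi : ℂ) - x))) ∧
      k x = -(b * l + c) * Complex.cosh (l * ((Real.pi : ℂ) - x)) -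
        c * l * (((Real.pi : ℂ) - x) * Complex.sinh (l * ((Real.pi : ℂ) - x))) := by
  have hsub : ∀ x : ℝ, HasDerivAt (fun y : ℝ => (Real.pi : ℂ) - y) (-1) x := fun x => by
    simpa using hasDerivAt_reflect 1 x
  -- `b` is determined by `f'(π) = -(b l + c)`
  set b : ℂ := -(k Real.pi + c) / l with hb
  have hbl : b * l = -(k Real.pi + c) := by rw [hb]; field_simp
  refine ⟨b, fun x hx => ?_⟩
  have h := eq_zero_of_hasDerivAt_of_right (l := l)
    (f := fun x => f x - (b * Complex.sinh (l * ((Real.pi : ℂ) - x)) +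
        c * (((Real.pi : ℂ) - x) * Complex.cosh (l * ((Real.pi : ℂ) - x)))))
    (k := fun x => k x - (-(b * l + c) * Complex.cosh (l * ((Real.pi : ℂ) - x)) -
        c * l * (((Real.pi : ℂ) - x) * Complex.sinh (l * ((Real.pi : ℂ) - x)))))
    (hf.sub (Continuous.continuousOn (by fun_prop)))
    (hk.sub (Continuous.continuousOn (by fun_prop)))
    (fun y hy => ((hfd y hy).sub (((hasDerivAt_sinh_reflect l y).const_mul b).add
      (((hsub y).mul (hasDerivAt_cosh_reflect l y)).const_mul c))).congr_deriv (by ring))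
    (fun y hy => ((hkd y hy).sub (((hasDerivAt_cosh_reflect l y).const_mul (-(b * l + c))).sub
      (((hsub y).mul (hasDerivAt_sinh_reflect l y)).const_mul (c * l)))).congr_deriv (by ring))
    (by simp [hf0]) (by simp only [sub_self, mul_zero, zero_mul, Complex.cosh_zero, hbl]; ring) hx
  exact ⟨sub_eq_zero.mp h.1, sub_eq_zero.mp h.2⟩

theorem exists_eq_of_hasDerivAt_zero {f k : ℝ → ℂ}
    (hf : ContinuousOn f (Set.Icc 0 Real.pi)) (hk : ContinuousOn k (Set.Icc 0 Real.pi))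
    (hfd : ∀ x ∈ Set.Ioo 0 Real.pi, HasDerivAt f (k x) x)
    (hkd : ∀ x ∈ Set.Ioo 0 Real.pi, HasDerivAt k 0 x) (hf0 : f Real.pi = 0) :
    ∃ b : ℂ, ∀ x ∈ Set.Icc 0 Real.pi, f x = b * ((Real.pi : ℂ) - x) ∧ k x = -b := by
  have hsub : ∀ x : ℝ, HasDerivAt (fun y : ℝ => (Real.pi : ℂ) - y) (-1) x := fun x => by
    simpa using hasDerivAt_reflect 1 x
  refine ⟨-k Real.pi, fun x hx => ?_⟩
  have h := eq_zero_of_hasDerivAt_of_right (l := 0)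
    (f := fun x => f x - (-k Real.pi) * ((Real.pi : ℂ) - x)) (k := fun x => k x - k Real.pi)
    (hf.sub (Continuous.continuousOn (by fun_prop))) (hk.sub continuousOn_const)
    (fun y hy => ((hfd y hy).sub ((hsub y).const_mul _)).congr_deriv (by ring))
    (fun y hy => ((hkd y hy).sub_const _).congr_deriv (by ring)) (by simp [hf0]) (by simp) hx
  rw [neg_neg]
  exact ⟨sub_eq_zero.mp h.1, sub_eq_zero.mp h.2⟩

/-- Regularity: a weak solution of `u'' = l² u + r` with continuous `r` is a classical one. -/
theorem exists_classical_solution {u g h r : L2Edge} {l : ℂ} {R : ℝ → ℂ}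
    (hug : IsWeakDeriv u g) (hgh : IsWeakDeriv g h) (hu : HasValueAt u Real.pi 0)
    (hR : ContinuousOn R (Set.Icc 0 Real.pi))
    (hr : ∀ᵐ x ∂(volume.restrict (Set.Ioo (0 : ℝ) Real.pi)), r x = R x)
    (hh : h = l ^ 2 • u + r) :
    ∃ f k : ℝ → ℂ, ContinuousOn f (Set.Icc 0 Real.pi) ∧ ContinuousOn k (Set.Icc 0 Real.pi) ∧
      (∀ᵐ x ∂(volume.restrict (Set.Ioo (0 : ℝ) Real.pi)), u x = f x) ∧
      (∀ᵐ x ∂(volume.restrict (Set.Ioo (0 : ℝ) Real.pi)), g x = k x) ∧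
      (∀ x ∈ Set.Ioo 0 Real.pi, HasDerivAt f (k x) x) ∧
      (∀ x ∈ Set.Ioo 0 Real.pi, HasDerivAt k (l ^ 2 * f x + R x) x) ∧ f Real.pi = 0 := by
  obtain ⟨f₀, c0, u0, -⟩ := id hu
  obtain ⟨k, ck, gk, dk⟩ := hgh.exists_hasDerivAt (k := fun x => l ^ 2 * f₀ x + R x)
    ((continuousOn_const.mul c0).add hR) (by
      rw [hh]
      filter_upwards [Lp.coeFn_add (l ^ 2 • u) r, Lp.coeFn_smul (l ^ 2) u, u0, hr]
        with x h1 h2 h3 h4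
      rw [h1, Pi.add_apply, h2, Pi.smul_apply, h3, h4, smul_eq_mul])
  obtain ⟨f, cf, uf, df⟩ := hug.exists_hasDerivAt ck gk
  have hff : Set.EqOn f f₀ (Set.Icc 0 Real.pi) := eqOn_of_ae_eq_edge cf c0 (by
    filter_upwards [uf, u0] with x h1 h2
    rw [← h1, h2])
  refine ⟨f, k, cf, ck, uf, gk, df, fun x hx => ?_, ?_⟩
  · rw [hff ⟨hx.1.le, hx.2.le⟩]
    exact dk x hx
  · exact (hu.eq_of_ae_eq (Set.right_mem_Icc.mpr Real.pi_pos.le) cf uf).symm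

/-- The element of `L²(0, π)` given by a continuous function. -/
def edgeOf (f : ℝ → ℂ) (hf : Continuous f) : L2Edge :=
  MemLp.toLp f (by
    obtain ⟨M, hM⟩ := (isCompact_Icc (a := (0 : ℝ)) (b := Real.pi)).exists_bound_of_continuousOn
      hf.continuousOn
    refine MemLp.of_bound hf.aestronglyMeasurable M ?_
    filter_upwards [ae_restrict_mem measurableSet_Ioo] with x hx
    exact hM x ⟨hx.1.le, hx.2.le⟩)

theorem edgeOf_ae {f : ℝ → ℂ} (hf : Continuous f) :
    ∀ᵐ x ∂(volume.restrict (Set.Ioo (0 : ℝ) Real.pi)), edgeOf f hf x = f x :=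
  MemLp.coeFn_toLp _

/-- The function `x ↦ sinh(l (π - x))` on an edge; it spans the solutions of `u'' = l² u` that
vanish at `π` when `l ≠ 0`. -/
def sinhEdge (l : ℂ) : L2Edge :=
  edgeOf (fun x => Complex.sinh (l * ((Real.pi : ℂ) - x))) (by fun_prop)

/-- The function `x ↦ cosh(l (π - x))` on an edge. -/
def coshEdge (l : ℂ) : L2Edge :=
  edgeOf (fun x => Complex.cosh (l * ((Real.pi : ℂ) - x))) (by fun_prop)

theorem sinhEdge_ae (l : ℂ) : ∀ᵐ x ∂(volume.restrict (Set.Ioo (0 : ℝ) Real.pi)),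
    sinhEdge l x = Complex.sinh (l * ((Real.pi : ℂ) - x)) := edgeOf_ae _

theorem hasValueAt_sinhEdge (l : ℂ) (x : ℝ) :
    HasValueAt (sinhEdge l) x (Complex.sinh (l * ((Real.pi : ℂ) - x))) :=
  ⟨_, Continuous.continuousOn (by fun_prop), sinhEdge_ae l, rfl⟩

theorem coshEdge_ae (l : ℂ) : ∀ᵐ x ∂(volume.restrict (Set.Ioo (0 : ℝ) Real.pi)),
    coshEdge l x = Complex.cosh (l * ((Real.pi : ℂ) - x)) := edgeOf_ae _

theorem hasValueAt_coshEdge (l : ℂ) (x : ℝ) :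
    HasValueAt (coshEdge l) x (Complex.cosh (l * ((Real.pi : ℂ) - x))) :=
  ⟨_, Continuous.continuousOn (by fun_prop), coshEdge_ae l, rfl⟩

theorem isWeakDeriv_sinhEdge (l : ℂ) : IsWeakDeriv (sinhEdge l) (-l • coshEdge l) := by
  refine isWeakDeriv_of_hasDerivAt (hasDerivAt_sinh_reflect l) (by fun_prop) (sinhEdge_ae l) ?_
  filter_upwards [Lp.coeFn_smul (-l) (coshEdge l),
    coshEdge_ae l] with x h1 h2
  rw [h1, Pi.smul_apply, h2, smul_eq_mul]

theorem isWeakDeriv_coshEdge (l : ℂ) : IsWeakDeriv (coshEdge l) (-l • sinhEdge l) := by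
  refine isWeakDeriv_of_hasDerivAt (hasDerivAt_cosh_reflect l) (by fun_prop) (coshEdge_ae l) ?_
  filter_upwards [Lp.coeFn_smul (-l) (sinhEdge l),
    sinhEdge_ae l] with x h1 h2
  rw [h1, Pi.smul_apply, h2, smul_eq_mul]

theorem hasValueAt_sinhEdge_zero (l : ℂ) :
    HasValueAt (sinhEdge l) 0 (Complex.sinh (l * Real.pi)) := by
  simpa using hasValueAt_sinhEdge l 0

theorem hasValueAt_sinhEdge_pi (l : ℂ) : HasValueAt (sinhEdge l) Real.pi 0 := by
  simpa using hasValueAt_sinhEdge l Real.pi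

theorem hasValueAt_coshEdge_zero (l : ℂ) :
    HasValueAt (coshEdge l) 0 (Complex.cosh (l * Real.pi)) := by
  simpa using hasValueAt_coshEdge l 0

theorem sinhEdge_ne_zero {l : ℂ} (hl : l ≠ 0) : sinhEdge l ≠ 0 := by
  intro h
  have h1 := isWeakDeriv_sinhEdge l
  rw [h] at h1
  have h2 := (smul_eq_zero.mp (h1.unique IsWeakDeriv.zero)).resolve_left (neg_ne_zero.mpr hl)
  have h3 : HasValueAt (coshEdge l) Real.pi 1 := by
    simpa using hasValueAt_coshEdge l Real.pi
  rw [h2] at h3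
  exact one_ne_zero (h3.unique (HasValueAt.zero _) (Set.right_mem_Icc.mpr Real.pi_pos.le))

/-- The edge data of a weak solution of `u'' = l² u + 2 l c sinh(l (π - x))` with `u(π) = 0`:
the amplitude `b` of its homogeneous part determines `u(0)` and `u'(0)`. -/
theorem exists_edge_solution {u g h : L2Edge} {l c : ℂ} (hl : l ≠ 0)
    (hug : IsWeakDeriv u g) (hgh : IsWeakDeriv g h) (hu : HasValueAt u Real.pi 0)
    (hh : h = l ^ 2 • u + (2 * l * c) • sinhEdge l) :
    ∃ b : ℂ, HasValueAt u 0 (b * Complex.sinh (l * Real.pi) +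
        c * (Real.pi * Complex.cosh (l * Real.pi))) ∧
      HasValueAt g 0 (-(b * l + c) * Complex.cosh (l * Real.pi) -
        c * l * (Real.pi * Complex.sinh (l * Real.pi))) ∧
      (c = 0 → u = b • sinhEdge l) := by
  obtain ⟨f, k, cf, ck, uf, gk, df, dk, f0⟩ := exists_classical_solution
    (R := fun x => 2 * l * c * Complex.sinh (l * ((Real.pi : ℂ) - x))) hug hgh hu
    (Continuous.continuousOn (by fun_prop)) (by
      filter_upwards [Lp.coeFn_smul (2 * l * c) (sinhEdge l),
        sinhEdge_ae l]
        with x h1 h2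
      rw [h1, Pi.smul_apply, h2, smul_eq_mul]) hh
  obtain ⟨b, hb⟩ := exists_eq_of_hasDerivAt hl cf ck df dk f0
  have h0 := hb 0 (Set.left_mem_Icc.mpr Real.pi_pos.le)
  refine ⟨b, ⟨f, cf, uf, by simpa using h0.1⟩, ⟨k, ck, gk, by simpa using h0.2⟩, fun hc => ?_⟩
  refine Lp.ext ?_
  filter_upwards [uf, Lp.coeFn_smul b (sinhEdge l), ae_restrict_mem measurableSet_Ioo,
    sinhEdge_ae l]
    with x h1 h2 h3 h4
  rw [h1, h2, Pi.smul_apply, h4, (hb x ⟨h3.1.le, h3.2.le⟩).1, hc, smul_eq_mul]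
  ring

theorem exists_edge_solution_zero {u g : L2Edge} (hug : IsWeakDeriv u g)
    (hgh : IsWeakDeriv g 0) (hu : HasValueAt u Real.pi 0) :
    ∃ b : ℂ, HasValueAt u 0 (b * Real.pi) ∧ HasValueAt g 0 (-b) ∧ (b = 0 → u = 0) := by
  obtain ⟨f, k, cf, ck, uf, gk, df, dk, f0⟩ := exists_classical_solution (l := 0) (r := 0)
    (R := fun _ => 0) hug hgh hu continuousOn_const
    (by
      filter_upwards [Lp.coeFn_zero ℂ 2 (volume.restrict (Set.Ioo (0 : ℝ) Real.pi))] with x hx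
      rw [hx, Pi.zero_apply]) (by simp)
  obtain ⟨b, hb⟩ := exists_eq_of_hasDerivAt_zero cf ck df (by simpa using dk) f0
  have h0 := hb 0 (Set.left_mem_Icc.mpr Real.pi_pos.le)
  refine ⟨b, ⟨f, cf, uf, by simpa using h0.1⟩, ⟨k, ck, gk, h0.2⟩, fun hc => ?_⟩
  refine Lp.ext ?_
  filter_upwards [uf, Lp.coeFn_zero ℂ 2 (volume.restrict (Set.Ioo (0 : ℝ) Real.pi)),
    ae_restrict_mem measurableSet_Ioo] with x h1 h2 h3
  rw [h1, h2, (hb x ⟨h3.1.le, h3.2.le⟩).1, hc, Pi.zero_apply, zero_mul]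

end StarGraph

/-! ### Kernels of powers of partially defined operators -/

namespace PartialOp

variable {E : Type*} [AddCommGroup E] [Module ℂ E]

theorem ker_ppow_zero (T : E →ₗ.[ℂ] E) : ker (ppow T 0) = {0} := by
  ext x
  refine ⟨fun ⟨_, h⟩ => h, fun h => ⟨trivial, h⟩⟩

theorem mem_ker_ppow_succ {T : E →ₗ.[ℂ] E} {k : ℕ} {x : E} :
    x ∈ ker (ppow T (k + 1)) ↔ ∃ h : x ∈ T.domain, T ⟨x, h⟩ ∈ ker (ppow T k) :=
  ⟨fun ⟨⟨h, h'⟩, e⟩ => ⟨h, h', e⟩, fun ⟨h, h', e⟩ => ⟨⟨h, h'⟩, e⟩⟩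

theorem mem_domain_sub_smul_ident {T : E →ₗ.[ℂ] E} {l : ℂ} {x : E} :
    x ∈ (T - l • ident).domain ↔ x ∈ T.domain :=
  ⟨fun h => h.1, fun h => ⟨h, trivial⟩⟩

theorem sub_smul_ident_apply {T : E →ₗ.[ℂ] E} {l : ℂ} {x : E}
    (h : x ∈ (T - l • ident).domain) (h' : x ∈ T.domain) :
    (T - l • ident : E →ₗ.[ℂ] E) ⟨x, h⟩ = T ⟨x, h'⟩ - l • x := rfl

/-- An eigenvalue without generalized eigenvectors of rank two has index one. -/
theorem IsEigenvalue.isIndex_one {T : E →ₗ.[ℂ] E} {l : ℂ} (hl : IsEigenvalue T l)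
    (hT : ∀ (x y : T.domain), T y = l • (y : E) → T x = l • (x : E) + y → (y : E) = 0) :
    IsIndex T l 1 := by
  have h1 : ∀ {x : E}, x ∈ ker (ppow (T - l • ident) 1) ↔
      ∃ h : x ∈ T.domain, T ⟨x, h⟩ = l • x := by
    intro x
    rw [mem_ker_ppow_succ, ker_ppow_zero]
    constructor
    · rintro ⟨h, e⟩
      refine ⟨h.1, ?_⟩
      rw [Set.mem_singleton_iff, sub_smul_ident_apply h h.1] at e
      exact sub_eq_zero.mp e
    · rintro ⟨h, e⟩
      refine ⟨mem_domain_sub_smul_ident.mpr h, ?_⟩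
      rw [Set.mem_singleton_iff, sub_smul_ident_apply _ h, e, sub_self]
  constructor
  · change ker _ = ker _
    ext x
    rw [h1, mem_ker_ppow_succ]
    constructor
    · rintro ⟨h, e⟩
      refine ⟨mem_domain_sub_smul_ident.mpr h, ?_⟩
      rw [sub_smul_ident_apply _ h, e, sub_self]
      exact h1.mpr ⟨T.domain.zero_mem, T.map_zero.trans (smul_zero l).symm⟩
    · rintro ⟨h, e⟩
      refine ⟨h.1, ?_⟩
      rw [sub_smul_ident_apply _ h.1] at e
      obtain ⟨h', e'⟩ := h1.mp e
      exact sub_eq_zero.mp (hT ⟨x, h.1⟩ ⟨_, h'⟩ e' (by simp))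
  · intro k hk
    by_contra hk0
    obtain rfl : k = 0 := by omega
    obtain ⟨x, hx0, hx⟩ := hl
    have : (x : E) ∈ ker (ppow (T - l • ident) 1) := h1.mpr ⟨x.2, hx⟩
    change ker _ = ker (ppow _ (0 + 1)) at hk
    rw [zero_add] at hk
    rw [← hk, ker_ppow_zero] at this
    exact hx0 this

end PartialOp

namespace StarGraph

/-! ### The characteristic function -/

theorem charFun_of_ne_zero {n : ℕ} {α l : ℂ} (hl : l ≠ 0) :
    charFun n α l = Complex.sinh (l * Real.pi) / l *
      (n * Complex.cosh (l * Real.pi) + α * Complex.sinh (l * Real.pi)) := by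
  rw [charFun, if_neg hl]

theorem hasDerivAt_sinh_mul_pi (l : ℂ) : HasDerivAt (fun l : ℂ => Complex.sinh (l * Real.pi))
    (Complex.cosh (l * Real.pi) * Real.pi) l := by
  simpa using ((hasDerivAt_id l).mul_const (Real.pi : ℂ)).csinh

theorem hasDerivAt_cosh_mul_pi (l : ℂ) : HasDerivAt (fun l : ℂ => Complex.cosh (l * Real.pi))
    (Complex.sinh (l * Real.pi) * Real.pi) l := by
  simpa using ((hasDerivAt_id l).mul_const (Real.pi : ℂ)).ccosh

theorem charFun_eq_dslope (n : ℕ) (α l : ℂ) : charFun n α l =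
    dslope (fun l : ℂ => Complex.sinh (l * Real.pi)) 0 l *
      (n * Complex.cosh (l * Real.pi) + α * Complex.sinh (l * Real.pi)) := by
  by_cases hl : l = 0
  · subst hl
    rw [dslope_same, (hasDerivAt_sinh_mul_pi 0).deriv, charFun, if_pos rfl]
    simp [mul_comm]
  · rw [dslope_of_ne _ hl, slope_def_field, charFun_of_ne_zero hl]
    simp

theorem differentiable_charFun (n : ℕ) (α : ℂ) : Differentiable ℂ (charFun n α) := by
  have h : charFun n α = fun l => dslope (fun l : ℂ => Complex.sinh (l * Real.pi)) 0 l *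
      (n * Complex.cosh (l * Real.pi) + α * Complex.sinh (l * Real.pi)) :=
    funext (charFun_eq_dslope n α)
  have hs : Differentiable ℂ (fun l : ℂ => Complex.sinh (l * Real.pi)) := fun l =>
    (hasDerivAt_sinh_mul_pi l).differentiableAt
  have hd : Differentiable ℂ (dslope (fun l : ℂ => Complex.sinh (l * Real.pi)) 0) := by
    rw [← differentiableOn_univ] at hs ⊢
    exact (Complex.differentiableOn_dslope Filter.univ_mem).mpr hs
  rw [h]
  exact hd.mul (by fun_prop)

theorem charFun_zero_ne_zero {n : ℕ} (hn : n ≠ 0) (α : ℂ) : charFun n α 0 ≠ 0 := by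
  rw [charFun, if_pos rfl]
  exact mul_ne_zero (Nat.cast_ne_zero.mpr hn) (Complex.ofReal_ne_zero.mpr Real.pi_ne_zero)

theorem charFun_eq_zero_iff {n : ℕ} {α l : ℂ} (hl : l ≠ 0) : charFun n α l = 0 ↔
    Complex.sinh (l * Real.pi) = 0 ∨
      n * Complex.cosh (l * Real.pi) + α * Complex.sinh (l * Real.pi) = 0 := by
  rw [charFun_of_ne_zero hl, mul_eq_zero, div_eq_zero_iff, or_iff_left hl]

/-- The second factor of the characteristic function has only simple zeros. -/
theorem sinh_add_cosh_ne_zero {n : ℕ} (hn : n ≠ 0) {α z : ℂ}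
    (h : n * Complex.cosh z + α * Complex.sinh z = 0) :
    n * Complex.sinh z + α * Complex.cosh z ≠ 0 := by
  intro h'
  refine (Nat.cast_ne_zero (R := ℂ)).mpr hn ?_
  linear_combination Complex.cosh z * h - Complex.sinh z * h' - n * Complex.cosh_sq_sub_sinh_sq z

theorem cosh_ne_zero_of_sinh_eq_zero {z : ℂ} (h : Complex.sinh z = 0) : Complex.cosh z ≠ 0 := by
  intro h'
  have := Complex.cosh_sq_sub_sinh_sq z
  rw [h, h'] at this
  norm_num at this

theorem analyticOrderAt_charFun {n : ℕ} (hn : n ≠ 0) {α l : ℂ} (h0 : charFun n α l = 0) :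
    analyticOrderAt (charFun n α) l = 1 := by
  have hl : l ≠ 0 := by
    rintro rfl
    exact charFun_zero_ne_zero hn α h0
  have hpi : (Real.pi : ℂ) ≠ 0 := Complex.ofReal_ne_zero.mpr Real.pi_ne_zero
  refine ((differentiable_charFun n α).analyticAt l).analyticOrderAt_eq_one_of_zero_deriv_ne_zero
    h0 ?_
  have he : charFun n α =ᶠ[nhds l] fun l => Complex.sinh (l * Real.pi) / l *
      (n * Complex.cosh (l * Real.pi) + α * Complex.sinh (l * Real.pi)) := by
    filter_upwards [isOpen_ne.mem_nhds hl] with z hz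
    exact charFun_of_ne_zero hz
  have hd := ((hasDerivAt_sinh_mul_pi l).div (hasDerivAt_id l) hl).mul
    (((hasDerivAt_cosh_mul_pi l).const_mul (n : ℂ)).add ((hasDerivAt_sinh_mul_pi l).const_mul α))
  have hd' := hd.congr_of_eventuallyEq he
  rw [hd'.deriv]
  simp only [Pi.add_apply, Pi.div_apply, id_eq, mul_one]
  rcases (charFun_eq_zero_iff hl).mp h0 with h | h
  · rw [h]
    have hc := cosh_ne_zero_of_sinh_eq_zero h
    have hn' : (n : ℂ) ≠ 0 := Nat.cast_ne_zero.mpr hn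
    simp only [zero_div, zero_mul, mul_zero, add_zero, sub_zero]
    positivity
  · rw [h, mul_zero, zero_add]
    have hs : Complex.sinh (l * Real.pi) ≠ 0 := by
      intro hs
      rw [hs, mul_zero, add_zero] at h
      exact mul_ne_zero (Nat.cast_ne_zero.mpr hn) (cosh_ne_zero_of_sinh_eq_zero hs) h
    refine mul_ne_zero (div_ne_zero hs hl) ?_
    have := mul_ne_zero (sinh_add_cosh_ne_zero hn h) hpi
    intro h'
    exact this (by linear_combination h')

/-! ### The eigenvalue equation as a system on the edges -/

theorem weakD2_eq_iff {u h : L2Edge} : (∃ hu : u ∈ weakD2.domain, weakD2 ⟨u, hu⟩ = h) ↔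
    ∃ g, IsWeakDeriv u g ∧ IsWeakDeriv g h := by
  constructor
  · rintro ⟨⟨h1, h2⟩, rfl⟩
    exact ⟨_, weakD_spec ⟨u, h1⟩, weakD_spec ⟨_, h2⟩⟩
  · rintro ⟨g, h1, h2⟩
    have hu : u ∈ weakD.domain := ⟨g, h1⟩
    have e : weakD ⟨u, hu⟩ = g := (weakD_spec ⟨u, hu⟩).unique h1
    have hg : weakD ⟨u, hu⟩ ∈ weakD.domain := ⟨h, by rw [e]; exact h2⟩
    refine ⟨⟨hu, hg⟩, ?_⟩
    have h3 := weakD_spec ⟨_, hg⟩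
    exact h3.unique (by change IsWeakDeriv (weakD ⟨u, hu⟩) h; rw [e]; exact h2)

/-- The equation `A_n(α) ψ = l ψ + χ` on the edges. -/
theorem waveOp_eq_iff {n : ℕ} {α l : ℂ} {ψ χ : Energy n} :
    (∃ h : ψ ∈ (waveOp n α).domain, waveOp n α ⟨ψ, h⟩ = l • ψ + χ) ↔
      ψ.2 = l • (ψ.1 : L2Star n) + χ.1 ∧
      ∃ (g : Fin n → L2Edge) (c : Fin n → ℂ) (d : ℂ),
        (∀ j, IsWeakDeriv ((ψ.1 : L2Star n) j) (g j)) ∧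
        (∀ j, IsWeakDeriv (g j) (l • ψ.2 j + χ.2 j)) ∧
        (∀ j, HasValueAt (g j) 0 (c j)) ∧ (∀ j, HasValueAt (ψ.2 j) 0 d) ∧
        ∑ j, c j = α * d := by
  constructor
  · rintro ⟨⟨h1, h2, c, d, h3, h4, h5⟩, e⟩
    have e1 : ψ.2 = l • (ψ.1 : L2Star n) + χ.1 := congrArg (fun p => (p.1 : L2Star n)) e
    have e2 : ∀ j, weakD2 ⟨(ψ.1 : L2Star n) j, h1 j⟩ = l • ψ.2 j + χ.2 j := fun j =>
      congrArg (fun p => p.2 j) e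
    choose g hg using id h3
    refine ⟨e1, g, c, d, fun j => (hg j).1, fun j => ?_, fun j => (hg j).2, h4, h5⟩
    obtain ⟨g', h6, h7⟩ := weakD2_eq_iff.mp ⟨h1 j, e2 j⟩
    rwa [(hg j).1.unique h6]
  · rintro ⟨e1, g, c, d, h1, h2, h3, h4, h5⟩
    have h6 := fun j => weakD2_eq_iff.mpr ⟨g j, h1 j, h2 j⟩
    have h7 : ψ.2 ∈ H10Star n := by
      rw [e1]
      exact (H10Star n).add_mem ((H10Star n).smul_mem l ψ.1.2) χ.1.2
    refine ⟨⟨fun j => (h6 j).1, h7, c, d, fun j => ⟨g j, h1 j, h3 j⟩, h4, h5⟩, ?_⟩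
    refine Prod.ext (Subtype.ext e1) (PiLp.ext fun j => ?_)
    exact (h6 j).2

/-! ### Eigenvectors and Jordan chains -/

/-- The equation `A_n(α) ψ = l ψ + χ` for `χ = (c_j sinh(l (π - x)), l c_j sinh(l (π - x)))_j`
in terms of the amplitudes `b` of the components of `ψ`. The case `c = 0` describes the
eigenvectors, the general case the Jordan chains of length two. -/
theorem exists_amplitudes {n : ℕ} {α l : ℂ} (hl : l ≠ 0) {ψ χ : Energy n} {c : Fin n → ℂ}
    (hχ1 : ∀ j, (χ.1 : L2Star n) j = c j • sinhEdge l) (hχ2 : χ.2 = l • (χ.1 : L2Star n))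
    (h : ∃ h : ψ ∈ (waveOp n α).domain, waveOp n α ⟨ψ, h⟩ = l • ψ + χ) :
    ψ.2 = l • (ψ.1 : L2Star n) + χ.1 ∧
    ∃ (b : Fin n → ℂ) (d : ℂ),
      (∀ j, b j * Complex.sinh (l * Real.pi) + c j * (Real.pi * Complex.cosh (l * Real.pi)) = d) ∧
      (∀ i, ∑ j, (-(b j * l + c j) * Complex.cosh (l * Real.pi) -
        c j * l * (Real.pi * Complex.sinh (l * Real.pi))) =
          α * (l * d + c i * Complex.sinh (l * Real.pi))) ∧
      (∀ j, c j = 0 → (ψ.1 : L2Star n) j = b j • sinhEdge l) := by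
  have hmem : (0 : ℝ) ∈ Set.Icc 0 Real.pi := Set.left_mem_Icc.mpr Real.pi_pos.le
  obtain ⟨e1, g, c', d', h1, h2, h3, h4, h5⟩ := waveOp_eq_iff.mp h
  refine ⟨e1, ?_⟩
  have e2 : ∀ j, ψ.2 j = l • (ψ.1 : L2Star n) j + c j • sinhEdge l := fun j => by
    rw [e1, PiLp.add_apply, PiLp.smul_apply, hχ1]
  have e3 : ∀ j, l • ψ.2 j + χ.2 j =
      l ^ 2 • (ψ.1 : L2Star n) j + (2 * l * c j) • sinhEdge l := fun j => by
    rw [e2, hχ2, PiLp.smul_apply, hχ1]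
    module
  choose b hb1 hb2 hb3 using fun j => exists_edge_solution (c := c j) hl (h1 j) (h2 j)
    (ψ.1.2.2.1 j) (e3 j)
  obtain ⟨d, hd⟩ := ψ.1.2.2.2
  have hbd := fun j => (hb1 j).unique (hd j) hmem
  refine ⟨b, d, hbd, fun i => ?_, hb3⟩
  have hd' : d' = l * d + c i * Complex.sinh (l * Real.pi) := by
    refine (h4 i).unique ?_ hmem
    rw [e2 i]
    exact ((hd i).smul l).add ((hasValueAt_sinhEdge_zero l).smul (c i))
  rw [← hd', ← h5]
  exact Finset.sum_congr rfl fun j _ => (hb2 j).unique (h3 j) hmem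

theorem exists_eigenvector_amplitudes {n : ℕ} (hn : n ≠ 0) {α l : ℂ} (hl : l ≠ 0)
    {ψ : (waveOp n α).domain} (h : waveOp n α ψ = l • (ψ : Energy n)) :
    ∃ (b : Fin n → ℂ) (d : ℂ),
      (∀ j, ((ψ : Energy n).1 : L2Star n) j = b j • sinhEdge l) ∧
      (ψ : Energy n).2 = l • ((ψ : Energy n).1 : L2Star n) ∧
      (∀ j, b j * Complex.sinh (l * Real.pi) = d) ∧
      (∑ j, b j) * Complex.cosh (l * Real.pi) = -(α * d) := by
  obtain ⟨e, b, d, h1, h2, h3⟩ := exists_amplitudes (ψ := (ψ : Energy n)) (χ := 0) (c := fun _ => 0) hl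
    (fun j => (zero_smul ℂ _).symm) (smul_zero l).symm ⟨ψ.2, h.trans (add_zero _).symm⟩
  refine ⟨b, d, fun j => h3 j rfl, e.trans (add_zero _), fun j => by simpa using h1 j, ?_⟩
  have h := h2 ⟨0, Nat.pos_of_ne_zero hn⟩
  simp only [add_zero, zero_mul, sub_zero, ← Finset.sum_mul, Finset.sum_neg_distrib] at h
  refine mul_left_cancel₀ hl ?_
  linear_combination -h

theorem isEigenvalue_of_amplitudes {n : ℕ} {α l : ℂ} (hl : l ≠ 0) {b : Fin n → ℂ} {d : ℂ}
    (hb : b ≠ 0) (h1 : ∀ j, b j * Complex.sinh (l * Real.pi) = d)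
    (h2 : (∑ j, b j) * Complex.cosh (l * Real.pi) = -(α * d)) :
    PartialOp.IsEigenvalue (waveOp n α) l := by
  have hv : ∀ j, HasValueAt (b j • sinhEdge l) 0 d := fun j => by
    rw [← h1 j]
    exact (hasValueAt_sinhEdge_zero l).smul (b j)
  let u : H10Star n := ⟨WithLp.toLp 2 fun j => b j • sinhEdge l,
    fun j => ⟨_, (isWeakDeriv_sinhEdge l).smul (b j)⟩,
    fun j => by simpa using (hasValueAt_sinhEdge_pi l).smul (b j), d, hv⟩
  obtain ⟨hψ, e⟩ := (waveOp_eq_iff (α := α) (l := l)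
      (ψ := ((u, l • (u : L2Star n)) : Energy n)) (χ := 0)).mpr
    ⟨(add_zero _).symm, fun j => b j • -l • coshEdge l,
      fun j => b j * (-l * Complex.cosh (l * Real.pi)), l * d,
      fun j => (isWeakDeriv_sinhEdge l).smul (b j), fun j => by
        have := ((isWeakDeriv_coshEdge l).smul (-l)).smul (b j)
        convert this using 1
        change l • l • b j • sinhEdge l + 0 = _
        module,
      fun j => ((hasValueAt_coshEdge_zero l).smul (-l)).smul (b j),
      fun j => (hv j).smul l, by
        rw [← Finset.sum_mul]
        linear_combination -l * h2⟩
  refine ⟨⟨_, hψ⟩, fun h0 => hb (funext fun j => ?_), by rw [e, add_zero]⟩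
  have : b j • sinhEdge l = 0 := congrArg (fun p : Energy n => (p.1 : L2Star n) j) h0
  exact (smul_eq_zero.mp this).resolve_right (sinhEdge_ne_zero hl)

theorem not_isEigenvalue_zero {n : ℕ} (hn : n ≠ 0) (α : ℂ) :
    ¬ PartialOp.IsEigenvalue (waveOp n α) 0 := by
  have hmem : (0 : ℝ) ∈ Set.Icc 0 Real.pi := Set.left_mem_Icc.mpr Real.pi_pos.le
  rintro ⟨⟨ψ, hψ⟩, h0, h⟩
  obtain ⟨e1, g, c, d, h1, h2, h3, h4, h5⟩ := waveOp_eq_iff.mp ⟨hψ, h.trans (add_zero _).symm⟩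
  have e2 : ψ.2 = 0 := by rw [e1]; simp
  have h2' : ∀ j, IsWeakDeriv (g j) 0 := fun j => by simpa using h2 j
  choose b hb1 hb2 hb3 using fun j => exists_edge_solution_zero (h1 j) (h2' j) (ψ.1.2.2.1 j)
  obtain ⟨e, he⟩ := ψ.1.2.2.2
  have hpi : (Real.pi : ℂ) ≠ 0 := Complex.ofReal_ne_zero.mpr Real.pi_ne_zero
  have hbe : ∀ j, b j = e / Real.pi := fun j => by
    rw [eq_div_iff hpi]
    exact (hb1 j).unique (he j) hmem
  have hd : d = 0 := by
    refine (h4 ⟨0, Nat.pos_of_ne_zero hn⟩).unique ?_ hmem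
    rw [e2]
    exact HasValueAt.zero 0
  have hc : ∀ j, c j = -(e / Real.pi) := fun j => by
    rw [← hbe j]
    exact (h3 j).unique (hb2 j) hmem
  rw [hd, mul_zero, Finset.sum_congr rfl fun j _ => hc j, Finset.sum_const, Finset.card_univ,
    Fintype.card_fin, smul_eq_zero, or_iff_right hn, neg_eq_zero] at h5
  refine h0 (Prod.ext (Subtype.ext (PiLp.ext fun j => ?_)) e2)
  exact hb3 j ((hbe j).trans h5)

theorem isEigenvalue_iff {n : ℕ} (hn : 2 ≤ n) {α l : ℂ} :
    PartialOp.IsEigenvalue (waveOp n α) l ↔ charFun n α l = 0 := by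
  have hn0 : n ≠ 0 := by omega
  by_cases hl : l = 0
  · subst hl
    exact iff_of_false (not_isEigenvalue_zero hn0 α) (charFun_zero_ne_zero hn0 α)
  rw [charFun_eq_zero_iff hl]
  constructor
  · rintro ⟨ψ, h0, h⟩
    obtain ⟨b, d, h1, h2, h3, h4⟩ := exists_eigenvector_amplitudes hn0 hl h
    by_contra! hS
    refine h0 ?_
    -- all amplitudes coincide, and their common value is a zero of the second factor
    have hb : ∀ j, b j = d / Complex.sinh (l * Real.pi) := fun j => by
      rw [eq_div_iff hS.1]
      exact h3 j
    rw [Finset.sum_congr rfl fun j _ => hb j, Finset.sum_const, Finset.card_univ,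
      Fintype.card_fin, nsmul_eq_mul] at h4
    have hd : d = 0 := by
      refine (mul_eq_zero.mp (?_ : d * (n * Complex.cosh (l * Real.pi) +
        α * Complex.sinh (l * Real.pi)) = 0)).resolve_right hS.2
      have hS1 := hS.1
      field_simp at h4
      linear_combination h4
    have h10 : (ψ : Energy n).1 = 0 := Subtype.ext (PiLp.ext fun j => by
      rw [h1, hb, hd, zero_div, zero_smul]; rfl)
    refine Prod.ext h10 ?_
    rw [h2, h10]
    exact smul_zero l
  · rintro (h | h)
    · -- two edges carry opposite sine waves that vanish at the vertex
      let i₀ : Fin n := ⟨0, by omega⟩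
      let i₁ : Fin n := ⟨1, by omega⟩
      have h01 : i₀ ≠ i₁ := by simp [i₀, i₁]
      refine isEigenvalue_of_amplitudes (b := Pi.single i₀ 1 - Pi.single i₁ 1) (d := 0) hl ?_
        (fun j => by rw [h, mul_zero]) ?_
      · intro h'
        have := congrFun h' i₀
        simp [h01] at this
      · simp
    · refine isEigenvalue_of_amplitudes (b := fun _ => 1) (d := Complex.sinh (l * Real.pi)) hl ?_
        (fun j => one_mul _) ?_
      · intro h'
        exact one_ne_zero (congrFun h' ⟨0, by omega⟩)
      · simp only [Finset.sum_const, Finset.card_univ, Fintype.card_fin, nsmul_eq_mul, mul_one]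
        linear_combination h

/-- There is no Jordan chain of length two, because the zeros of the characteristic function are
simple. -/
theorem eq_zero_of_jordan_chain {n : ℕ} (hn : n ≠ 0) {α l : ℂ} (hl : l ≠ 0)
    {ψ χ : (waveOp n α).domain} (hχ : waveOp n α χ = l • (χ : Energy n))
    (hψ : waveOp n α ψ = l • (ψ : Energy n) + χ) : (χ : Energy n) = 0 := by
  obtain ⟨c, e, h1, h2, h3, h4⟩ := exists_eigenvector_amplitudes hn hl hχ
  obtain ⟨-, b, d, k1, k2, -⟩ := exists_amplitudes (ψ := (ψ : Energy n))
    (χ := (χ : Energy n)) hl h1 h2 ⟨ψ.2, hψ⟩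
  have hn' : (n : ℂ) ≠ 0 := Nat.cast_ne_zero.mpr hn
  have hpi : (Real.pi : ℂ) ≠ 0 := Complex.ofReal_ne_zero.mpr Real.pi_ne_zero
  suffices hc : ∀ j, c j = 0 by
    have h10 : (χ : Energy n).1 = 0 := Subtype.ext (PiLp.ext fun j => by
      rw [h1, hc, zero_smul]; rfl)
    refine Prod.ext h10 ?_
    rw [h2, h10]
    exact smul_zero l
  set S := Complex.sinh (l * Real.pi) with hS
  set C := Complex.cosh (l * Real.pi) with hC
  by_cases hS0 : S = 0
  · have hC0 : C ≠ 0 := cosh_ne_zero_of_sinh_eq_zero hS0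
    have hcd : ∀ j, c j = d / (Real.pi * C) := fun j => by
      rw [eq_div_iff (mul_ne_zero hpi hC0), ← k1 j, hS0]
      ring
    intro j
    have he : e = 0 := by rw [← h3 j, hS0, mul_zero]
    rw [he, mul_zero, neg_zero, mul_eq_zero, or_iff_left hC0,
      Finset.sum_congr rfl fun j _ => hcd j, Finset.sum_const, Finset.card_univ,
      Fintype.card_fin, smul_eq_zero, or_iff_right hn] at h4
    rw [hcd j, h4]
  · intro i
    have hce : ∀ j, c j = c i := fun j => mul_right_cancel₀ hS0 ((h3 j).trans (h3 i).symm)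
    have hbe : ∀ j, b j = b i := fun j => by
      have := (k1 j).trans (k1 i).symm
      rw [hce j] at this
      exact mul_right_cancel₀ hS0 (by linear_combination this)
    have k3 := k2 i
    rw [Finset.sum_congr rfl fun j _ => by rw [hce j, hbe j], Finset.sum_const, Finset.card_univ,
      Fintype.card_fin, nsmul_eq_mul, ← k1 i] at k3
    rw [Finset.sum_congr rfl fun j _ => hce j, Finset.sum_const, Finset.card_univ,
      Fintype.card_fin, nsmul_eq_mul, ← h3 i] at h4
    by_contra hci
    have hz : n * C + α * S = 0 := mul_left_cancel₀ hci (by linear_combination h4)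
    refine sinh_add_cosh_ne_zero hn hz ?_
    refine mul_left_cancel₀ (mul_ne_zero (mul_ne_zero hci hl) hpi) ?_
    linear_combination -k3 - (b i * l + c i) * hz

end StarGraph
end

theorem mainTheorem11 (n : ℕ) (hn : 2 ≤ n) (α : ℂ) :
    Differentiable ℂ (StarGraph.charFun n α) ∧
    (∀ l : ℂ, PartialOp.IsEigenvalue (StarGraph.waveOp n α) l ↔ StarGraph.charFun n α l = 0) ∧
    (∀ l : ℂ, PartialOp.IsEigenvalue (StarGraph.waveOp n α) l →
      ∃ m : ℕ, PartialOp.IsIndex (StarGraph.waveOp n α) l m ∧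
        analyticOrderAt (StarGraph.charFun n α) l = m) := by
  have hn0 : n ≠ 0 := by omega
  refine ⟨StarGraph.differentiable_charFun n α, fun l => StarGraph.isEigenvalue_iff hn,
    fun l hl => ⟨1, ?_, ?_⟩⟩
  · have hl0 : l ≠ 0 := by
      rintro rfl
      exact StarGraph.not_isEigenvalue_zero hn0 α hl
    exact hl.isIndex_one fun ψ χ hχ hψ => StarGraph.eq_zero_of_jordan_chain hn0 hl0 hχ hψ
  · rw [StarGraph.analyticOrderAt_charFun hn0 ((StarGraph.isEigenvalue_iff hn).mp hl)]
    rfl
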